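/- Let $n\ge 1$ and let $H_{2n+1}$ be the Heisenberg group, i.e. $\mathbb{R}^{2n}\times\mathbb{R}$ with the multiplication $(x,s)\cdot(y,t)=(x+y,\,s+t+\omega(x,y))$, where $\omega$ is the standard symplectic form on $\mathbb{R}^{2n}$; let $Z$ be the left-invariant vector field with value $(0,1)$ at the unit element $e$. Let $F(a,v)=\sqrt{g_a(v,v)}+g_a(Q(a),v)$ be a left-invariant Randers metric on $H_{2n+1}$, where $g$ is a smooth Riemannian metric and $Q$ a smooth vector field with $g(Q,Q)<1$, and left-invariance means $F(a,v)=F(e,d(L_{a^{-1}})_a v)$ for all $a$ and $v$ (equivalently, $g$ and $Q$ are left-invariant). Call $F$ of Douglas type if the one-form $g(Q,\cdot)$ is closed, a $Z$-Randers metric if $Q=cZ$ for a constant $c\in\mathbb{R}$, and a geodesic orbit metric if every (constant speed) geodesic of $F$ runs along an orbit of a one-parameter group of isometries of $F$, i.e. for every geodesic $\gamma:I\to H_{2n+1}$ there is a one-parameter group $(\Phi_t)_{t\in\mathbb{R}}$ of isometries of $F$ with $\gamma(t)=\Phi_{t-s}(\gamma(s))$ for all $s,t\in I$. Then: (1) if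 $Q\neq 0$ and $F$ is of Douglas type, then $F$ is not a geodesic orbit metric; (2) if $F$ is a geodesic orbit metric, then $F$ is a $Z$-Randers metric. -/

import Mathlib

open scoped ContDiff Manifold

noncomputable section

/-! ### The Heisenberg group -/

/-- The base manifold `ℝ²ⁿ × ℝ` of the Heisenberg group, a point of `ℝ²ⁿ` being written as
a pair `(p, q)` of vectors of `ℝⁿ`; so a point is `(p, q, t)`. -/
def Heis (n : ℕ) : Type := (Fin n → ℝ) × (Fin n → ℝ) × ℝ

namespace Heis

variable {n : ℕ}

/-- The (sup) norm only provides the topology and the smooth structure of `ℝ²ⁿ⁺¹`. -/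
instance : NormedAddCommGroup (Heis n) :=
  inferInstanceAs (NormedAddCommGroup ((Fin n → ℝ) × (Fin n → ℝ) × ℝ))

instance : NormedSpace ℝ (Heis n) :=
  inferInstanceAs (NormedSpace ℝ ((Fin n → ℝ) × (Fin n → ℝ) × ℝ))

instance : FiniteDimensional ℝ (Heis n) :=
  inferInstanceAs (FiniteDimensional ℝ ((Fin n → ℝ) × (Fin n → ℝ) × ℝ))

/-- The standard symplectic form of `ℝ²ⁿ`, applied to the `ℝ²ⁿ`-components of two points. -/
def omega (a b : Heis n) : ℝ := ∑ i, (a.1 i * b.2.1 i - a.2.1 i * b.1 i)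

/-- `(x, s) · (y, t) = (x + y, s + t + ω(x, y))`. -/
instance : Mul (Heis n) :=
  ⟨fun a b => (a.1 + b.1, a.2.1 + b.2.1, a.2.2 + b.2.2 + omega a b)⟩

instance : One (Heis n) := ⟨((0 : Fin n → ℝ), (0 : Fin n → ℝ), (0 : ℝ))⟩

instance : Inv (Heis n) := ⟨fun a => (-a.1, -a.2.1, -a.2.2)⟩

instance : Group (Heis n) :=
  Group.ofLeftAxioms
    (by
      intro a b c
      refine Prod.ext (add_assoc _ _ _) (Prod.ext (add_assoc _ _ _) ?_)
      change (a.2.2 + b.2.2 + omega a b) + c.2.2 +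
          ∑ i, ((a.1 i + b.1 i) * c.2.1 i - (a.2.1 i + b.2.1 i) * c.1 i) =
        a.2.2 + (b.2.2 + c.2.2 + omega b c) +
          ∑ i, (a.1 i * (b.2.1 i + c.2.1 i) - a.2.1 i * (b.1 i + c.1 i))
      have h : omega a b +
          ∑ i, ((a.1 i + b.1 i) * c.2.1 i - (a.2.1 i + b.2.1 i) * c.1 i) =
          omega b c +
          ∑ i, (a.1 i * (b.2.1 i + c.2.1 i) - a.2.1 i * (b.1 i + c.1 i)) := by
        unfold omega
        rw [← Finset.sum_add_distrib, ← Finset.sum_add_distrib]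
        exact Finset.sum_congr rfl fun i _ => by ring
      linarith)
    (by
      intro a
      refine Prod.ext (zero_add _) (Prod.ext (zero_add _) ?_)
      change (0 : ℝ) + a.2.2 + ∑ i, ((0 : ℝ) * a.2.1 i - 0 * a.1 i) = a.2.2
      simp)
    (by
      intro a
      refine Prod.ext (neg_add_cancel _) (Prod.ext (neg_add_cancel _) ?_)
      change -a.2.2 + a.2.2 + ∑ i, (-a.1 i * a.2.1 i - -a.2.1 i * a.1 i) = 0
      simp [mul_comm])

/-- The left-invariant vector field with value `v` at the unit element,
`a ↦ d(L_a)_e v`. -/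
def leftInvariantField (v : Heis n) (a : Heis n) : Heis n :=
  fderiv ℝ (fun y : Heis n => a * y) 1 v

/-- The left-invariant vector field `Z` that spans the centre of the Heisenberg algebra. -/
def Z (n : ℕ) : Heis n → Heis n :=
  leftInvariantField ((0 : Fin n → ℝ), (0 : Fin n → ℝ), (1 : ℝ))

/-- A function `F` on the tangent bundle is left-invariant if
`F(a, v) = F(e, d(L_{a⁻¹}) v)`. -/
def LeftInvariant (F : Heis n → Heis n → ℝ) : Prop :=
  ∀ a v : Heis n, F a v = F 1 (fderiv ℝ (fun y : Heis n => a⁻¹ * y) a v)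

end Heis

/-! ### Randers metrics, geodesics and isometries

A manifold with a global chart is identified with its model space `E`, and its tangent
bundle with `E × E`; a Finsler metric is then a function `F : E → E → ℝ` of the base point `x`
and the tangent vector `y`. -/

section Finsler

variable {E : Type*} [NormedAddCommGroup E] [NormedSpace ℝ E]

variable (E) in
/-- The data of a Randers metric: a smooth Riemannian metric `g` and a smooth vector field
`X` with `g(X, X) < 1` everywhere. -/
structure RandersMetric where
  /-- the Riemannian metric -/
  g : E → E →L[ℝ] E →L[ℝ] ℝ
  /-- the vector field -/
  X : E → E
  smooth_g : ContDiff ℝ ∞ g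
  symm_g : ∀ x u v, g x u v = g x v u
  pos_g : ∀ x v, v ≠ 0 → 0 < g x v v
  smooth_X : ContDiff ℝ ∞ X
  lt_one : ∀ x, g x (X x) (X x) < 1

/-- The Randers metric `F(x, y) = √g(y, y) + g(X(x), y)`. -/
def RandersMetric.F (R : RandersMetric E) (x y : E) : ℝ :=
  √(R.g x y y) + R.g x (R.X x) y

/-- A Randers metric is of Douglas type if the one-form `g(X, ·)` is closed. -/
def RandersMetric.IsDouglas (R : RandersMetric E) : Prop :=
  ∀ x, extDeriv (fun x => ContinuousAlternatingMap.ofSubsingleton ℝ E ℝ (0 : Fin 1)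
    (R.g x (R.X x))) x = 0

/-- The curve `γ`, on the open set `I` of times, is a (nonconstant, constant speed) geodesic
of `F`: a regular `C²` curve that satisfies the Euler–Lagrange equation
`d/dt (∂L/∂y (γ, γ')) = ∂L/∂x (γ, γ')` of the energy density `L = F² / 2`. -/
def IsFinslerGeodesicOn (F : E → E → ℝ) (γ : ℝ → E) (I : Set ℝ) : Prop :=
  ContDiffOn ℝ 2 γ I ∧ ∀ t ∈ I, deriv γ t ≠ 0 ∧
    HasDerivAt (fun s => fderiv ℝ (fun y => F (γ s) y ^ 2 / 2) (deriv γ s))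
      (fderiv ℝ (fun x => F x (deriv γ t) ^ 2 / 2) (γ t)) t

/-- A one-parameter group of isometries of `F`: a continuous action `Φ` of `(ℝ, +)` by smooth
maps (hence diffeomorphisms, `Φ t` having the inverse `Φ (-t)`) that preserve `F`. -/
structure IsOneParamIsometryGroup (F : E → E → ℝ) (Φ : ℝ → E → E) : Prop where
  continuous_uncurry : Continuous fun p : ℝ × E => Φ p.1 p.2
  map_zero : ∀ x, Φ 0 x = x
  map_add : ∀ s t x, Φ (s + t) x = Φ s (Φ t x)
  smooth : ∀ t, ContDiff ℝ ∞ (Φ t)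
  isometry : ∀ t x v, F (Φ t x) (fderiv ℝ (Φ t) x v) = F x v

/-- Geodesic orbit spaces: every geodesic, defined on an arbitrary open interval `I`, runs
along an orbit of a one-parameter group of isometries. -/
def IsGeodesicOrbit (F : E → E → ℝ) : Prop :=
  ∀ (γ : ℝ → E) (I : Set ℝ), IsOpen I → I.OrdConnected → IsFinslerGeodesicOn F γ I →
    ∃ Φ : ℝ → E → E, IsOneParamIsometryGroup F Φ ∧
      ∀ s ∈ I, ∀ t ∈ I, γ t = Φ (t - s) (γ s)

end Finsler

/-- A Randers metric on the Heisenberg group is a `Z`-Randers metric if its vector field is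
a constant multiple of `Z`. -/
def RandersMetric.IsZRanders {n : ℕ} (R : RandersMetric (Heis n)) : Prop :=
  ∃ c : ℝ, ∀ a, R.X a = c • Heis.Z n a

end

open Set Filter Topology

/-! ### Positive definite forms -/

section Form

variable {E : Type*} [NormedAddCommGroup E] [NormedSpace ℝ E] {B : E →L[ℝ] E →L[ℝ] ℝ}

/-! Write `B = g_e`, `x = Q(e)` and `z` for the central unit vector. An isometry of `F` preserves
the odd part of `F` in the velocity, which is the one-form `g(Q, ·)`; so this form is constant on
the velocity of any geodesic that is an orbit (`form_X_deriv_eq_of_orbit`). Left-trivialized, a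
unit-speed geodesic has velocity `e / (1 + B(x, e))` with `B(e, e) = 1`. Its central momentum `κ =
B(e, z) + B(x, z)` is conserved, and `e' = 2κ / (1 + B(x, e)) • J e`, where `B(J u, w) = ω(u, w)`
(`exists_geodesic`). Constancy of `B(x, e)` then gives `κ ω(e, x) = 0` for every unit `e`. If `ω(w,
x) ≠ 0`, then `κ` vanishes on all normalized `w + s z`, though `B(·, z)` takes both signs there.
Hence `x` is central, which is (2). For (1), `Q = cZ` makes `d g(Q, ·)` a multiple of `ω` with
factor proportional to `c B(z, z)`, so closedness forces `c = 0`. -/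

theorem form_apply_lt_one (hs : ∀ u v, B u v = B v u) (hp : ∀ v, v ≠ 0 → 0 < B v v) {x e : E}
    (hx : B x x < 1) (he : B e e = 1) : 0 < 1 + B x e := by
  -- Orthogonal projection off `e` gives `B(x, e)² ≤ B(x, x) < 1`.
  have h0 : 0 ≤ B (x - B x e • e) (x - B x e • e) := by
    by_cases h : x - B x e • e = 0
    · simp [h]
    · exact (hp _ h).le
  simp only [map_sub, map_smul, sub_apply, smul_apply, smul_eq_mul, he, hs e x] at h0
  nlinarith

theorem exists_form_representative [FiniteDimensional ℝ E] (hp : ∀ v, v ≠ 0 → 0 < B v v)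
    (A : E →L[ℝ] E →L[ℝ] ℝ) : ∃ J : E →L[ℝ] E, ∀ u w, B (J u) w = A u w := by
  let b : LinearMap.BilinForm ℝ E :=
    (ContinuousLinearMap.coeLM ℝ).comp (B : E →ₗ[ℝ] E →L[ℝ] ℝ)
  have hinj : Function.Injective b := by
    rw [injective_iff_map_eq_zero]
    intro v hv
    by_contra h
    have := hp v h
    have h2 : b v v = 0 := by rw [hv]; rfl
    exact this.ne' h2
  let T : E ≃ₗ[ℝ] Module.Dual ℝ E :=
    LinearEquiv.ofInjectiveOfFinrankEq b hinj Subspace.dual_finrank_eq.symm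
  let a : E →ₗ[ℝ] Module.Dual ℝ E :=
    (ContinuousLinearMap.coeLM ℝ).comp (A : E →ₗ[ℝ] E →L[ℝ] ℝ)
  refine ⟨(T.symm.toLinearMap.comp a).toContinuousLinearMap, fun u w => ?_⟩
  have h : T (T.symm (a u)) = a u := T.apply_symm_apply _
  exact congrArg (fun f : Module.Dual ℝ E => f w) h

/-- The Minkowski norm `y ↦ √B(y, y) + B(x, y)`. -/
noncomputable def randersNorm (B : E →L[ℝ] E →L[ℝ] ℝ) (x y : E) : ℝ := √(B y y) + B x y

theorem hasFDerivAt_half_sq_randersNorm (hs : ∀ u v, B u v = B v u) {x e : E} {r : ℝ}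
    (hr : 0 < r) (he : B e e = 1) :
    HasFDerivAt (fun y => randersNorm B x y ^ 2 / 2)
      ((r * (1 + B x e)) • (B e + B x)) (r • e) := by
  have hB : HasFDerivAt (fun y => B y y) ((2 * r) • B e) (r • e) := by
    have h := B.hasFDerivAt_of_bilinear (hasFDerivAt_id (r • e)) (hasFDerivAt_id (r • e))
    refine h.congr_fderiv ?_
    ext w
    simp [hs w e]
    ring
  have hval : B (r • e) (r • e) = r ^ 2 := by
    simp [he]
    ring
  have h1 := (hB.sqrt (by rw [hval]; positivity)).add (B x).hasFDerivAt
  have h2 := (h1.pow 2).mul_const (1 / 2 : ℝ)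
  refine (h2.congr_fderiv ?_).congr_of_eventuallyEq (Eventually.of_forall fun y => ?_)
  · ext w
    have hsq : √(B (r • e) (r • e)) = r := by rw [hval, Real.sqrt_sq hr.le]
    simp only [Pi.add_apply, hsq]
    simp
    field_simp
  · simp [randersNorm, div_eq_mul_inv]

end Form

/-! ### Symplectic form, centre and left trivialization -/

namespace Heis

variable {n : ℕ}

/-- The unit vector that spans the centre. -/
noncomputable def centre (n : ℕ) : Heis n := ((0 : Fin n → ℝ), (0 : Fin n → ℝ), (1 : ℝ))

theorem omega_add_left (a b c : Heis n) : omega (a + b) c = omega a c + omega b c := by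
  unfold omega
  rw [← Finset.sum_add_distrib]
  refine Finset.sum_congr rfl fun i _ => ?_
  change (a.1 i + b.1 i) * _ - (a.2.1 i + b.2.1 i) * _ = _
  ring

theorem omega_smul_left (r : ℝ) (a b : Heis n) : omega (r • a) b = r * omega a b := by
  unfold omega
  rw [Finset.mul_sum]
  refine Finset.sum_congr rfl fun i _ => ?_
  change (r * a.1 i) * _ - (r * a.2.1 i) * _ = _
  ring

theorem omega_swap (a b : Heis n) : omega a b = -omega b a := by
  unfold omega
  rw [← Finset.sum_neg_distrib]
  exact Finset.sum_congr rfl fun i _ => by ring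

/-- The symplectic form as a continuous bilinear map. -/
noncomputable def omegaL (n : ℕ) : Heis n →L[ℝ] Heis n →L[ℝ] ℝ :=
  (LinearMap.toContinuousLinearMap.toLinearMap.comp
    (LinearMap.mk₂ ℝ (omega (n := n)) omega_add_left omega_smul_left
      (fun a b c => by
        rw [omega_swap, omega_add_left, neg_add, ← omega_swap, ← omega_swap])
      (fun r a b => by
        rw [omega_swap, omega_smul_left, omega_swap b, smul_eq_mul]; ring))).toContinuousLinearMap

theorem omegaL_apply (a b : Heis n) : omegaL n a b = omega a b := rfl

theorem omegaL_swap (a b : Heis n) : omegaL n a b = -omegaL n b a := omega_swap a b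

@[simp]
theorem omegaL_self (a : Heis n) : omegaL n a a = 0 := by
  have := omegaL_swap a a
  linarith

@[simp]
theorem omegaL_centre_right (a : Heis n) : omegaL n a (centre n) = 0 := by
  rw [omegaL_apply]
  simp [omega, centre]

@[simp]
theorem omegaL_centre_left (a : Heis n) : omegaL n (centre n) a = 0 := by
  rw [omegaL_swap, omegaL_centre_right, neg_zero]

theorem centre_ne_zero : centre n ≠ 0 := fun h =>
  one_ne_zero (congrArg (fun a : Heis n => a.2.2) h)

theorem eq_smul_centre_of_omegaL_eq_zero {a : Heis n} (h : ∀ w, omegaL n w a = 0) :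
    a = a.2.2 • centre n := by
  have h1 : a.1 = 0 := by
    funext i
    have : omega (n := n) ((0 : Fin n → ℝ), Pi.single i (1 : ℝ), (0 : ℝ)) a = 0 := h _
    simpa [omega, Pi.single_apply] using this
  have h2 : a.2.1 = 0 := by
    funext i
    have : omega (n := n) (Pi.single i (1 : ℝ), (0 : Fin n → ℝ), (0 : ℝ)) a = 0 := h _
    simpa [omega, Pi.single_apply] using this
  refine Prod.ext ?_ (Prod.ext ?_ ?_)
  · change a.1 = a.2.2 • (0 : Fin n → ℝ)
    rw [h1, smul_zero]
  · change a.2.1 = a.2.2 • (0 : Fin n → ℝ)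
    rw [h2, smul_zero]
  · change a.2.2 = a.2.2 • (1 : ℝ)
    simp

theorem mul_eq (a y : Heis n) : a * y = a + (y + omegaL n a y • centre n) := by
  refine Prod.ext ?_ (Prod.ext ?_ ?_)
  · change a.1 + y.1 = a.1 + (y.1 + omega a y • (0 : Fin n → ℝ))
    simp
  · change a.2.1 + y.2.1 = a.2.1 + (y.2.1 + omega a y • (0 : Fin n → ℝ))
    simp
  · change a.2.2 + y.2.2 + omega a y = a.2.2 + (y.2.2 + omega a y • (1 : ℝ))
    simp [add_assoc]

theorem inv_eq (a : Heis n) : a⁻¹ = -a := rfl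

theorem one_eq : (1 : Heis n) = 0 := rfl

theorem fderiv_mul_left (a x v : Heis n) :
    fderiv ℝ (fun y : Heis n => a * y) x v = v + omegaL n a v • centre n := by
  have h : HasFDerivAt (fun y : Heis n => a * y)
      (ContinuousLinearMap.id ℝ (Heis n) + (omegaL n a).smulRight (centre n)) x := by
    refine HasFDerivAt.congr_of_eventuallyEq ?_ (Eventually.of_forall (mul_eq a))
    exact ((hasFDerivAt_id x).add ((omegaL n a).smulRight (centre n)).hasFDerivAt).const_add a
  rw [h.fderiv]
  rfl

theorem leftInvariantField_apply (v a : Heis n) :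
    leftInvariantField v a = v + omegaL n a v • centre n := fderiv_mul_left _ _ _

theorem Z_apply (a : Heis n) : Z n a = centre n := by
  have : Z n a = leftInvariantField (centre n) a := rfl
  rw [this, leftInvariantField_apply]
  simp

/-- The differential at `a` of the left translation by `a⁻¹`. -/
noncomputable def trivialize (a : Heis n) : Heis n →L[ℝ] Heis n :=
  ContinuousLinearMap.id ℝ (Heis n) - (omegaL n a).smulRight (centre n)

theorem trivialize_apply (a v : Heis n) : trivialize a v = v - omegaL n a v • centre n := rfl

theorem trivialize_translate (a v : Heis n) :
    trivialize a (v + omegaL n a v • centre n) = v := by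
  simp [trivialize_apply]

theorem translate_trivialize (a v : Heis n) :
    trivialize a v + omegaL n a (trivialize a v) • centre n = v := by
  simp [trivialize_apply]

end Heis

/-! ### Recovering the metric and the vector field from `F` -/

namespace RandersMetric

/-- The square root is even in `y`, so `F` alone determines the one-form; every symmetry of `F`
therefore respects it. -/
theorem half_F_sub {E : Type*} [NormedAddCommGroup E] [NormedSpace ℝ E] (R : RandersMetric E)
    (x y : E) : R.F x y - R.F x (-y) = 2 * R.g x (R.X x) y := by
  simp [RandersMetric.F]
  ring

variable {n : ℕ} {R : RandersMetric (Heis n)}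

theorem F_eq_of_leftInvariant (hR : Heis.LeftInvariant R.F) (a v : Heis n) :
    R.F a v = randersNorm (R.g 0) (R.X 0) (Heis.trivialize a v) := by
  rw [hR a v, Heis.fderiv_mul_left, Heis.inv_eq, Heis.one_eq, Heis.trivialize_apply]
  simp [RandersMetric.F, randersNorm, sub_eq_add_neg]

theorem form_X_of_leftInvariant (hR : Heis.LeftInvariant R.F) (a v : Heis n) :
    R.g a (R.X a) v = R.g 0 (R.X 0) (Heis.trivialize a v) := by
  have h := R.half_F_sub a v
  rw [F_eq_of_leftInvariant hR, F_eq_of_leftInvariant hR] at h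
  simp [randersNorm] at h
  linarith

theorem g_self_of_leftInvariant (hR : Heis.LeftInvariant R.F) (a v : Heis n) :
    R.g a v v = R.g 0 (Heis.trivialize a v) (Heis.trivialize a v) := by
  have hnn : ∀ x w : Heis n, 0 ≤ R.g x w w := fun x w => by
    by_cases h : w = 0
    · simp [h]
    · exact (R.pos_g x w h).le
  have h := F_eq_of_leftInvariant hR a v
  have h2 := form_X_of_leftInvariant hR a v
  unfold RandersMetric.F randersNorm at h
  rw [h2, add_left_inj] at h
  exact (Real.sqrt_inj (hnn _ _) (hnn _ _)).1 h

theorem g_of_leftInvariant (hR : Heis.LeftInvariant R.F) (a v w : Heis n) :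
    R.g a v w = R.g 0 (Heis.trivialize a v) (Heis.trivialize a w) := by
  have h := g_self_of_leftInvariant hR a (v + w)
  simp only [map_add, add_apply] at h
  rw [g_self_of_leftInvariant hR a v, g_self_of_leftInvariant hR a w, R.symm_g a w v,
    R.symm_g 0 (Heis.trivialize a w) (Heis.trivialize a v)] at h
  linarith

theorem trivialize_X (hR : Heis.LeftInvariant R.F) (a : Heis n) :
    Heis.trivialize a (R.X a) = R.X 0 := by
  by_contra hne
  have hp := R.pos_g 0 _ (sub_ne_zero.2 hne)
  set d := Heis.trivialize a (R.X a) - R.X 0 with hd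
  -- Test the one-form on the left translate of `d` to get `g(d, d) = 0`.
  have h := form_X_of_leftInvariant hR a (d + Heis.omegaL n a d • Heis.centre n)
  rw [g_of_leftInvariant hR, Heis.trivialize_translate] at h
  have h2 : R.g 0 d d = R.g 0 (Heis.trivialize a (R.X a)) d - R.g 0 (R.X 0) d := by
    rw [← sub_apply, ← map_sub]
  linarith

end RandersMetric

/-! ### Invariance along orbits of isometries -/

section Isometry

variable {E : Type*} [NormedAddCommGroup E] [NormedSpace ℝ E]

theorem deriv_eq_fderiv_of_orbit {Φ : E → E} {γ : ℝ → E} {I : Set ℝ} (hI : IsOpen I)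
    (hγ : ∀ t ∈ I, DifferentiableAt ℝ γ t) (hΦ : Differentiable ℝ Φ) {s t : ℝ} (hs : s ∈ I)
    (ht : t ∈ I) (h : ∀ u ∈ I, u + (t - s) ∈ I → γ (u + (t - s)) = Φ (γ u)) :
    deriv γ t = fderiv ℝ Φ (γ s) (deriv γ s) := by
  have h1 : HasDerivAt (fun u => γ (u + (t - s))) (deriv γ t) s := by
    apply HasDerivAt.comp_add_const
    rw [add_sub_cancel]
    exact (hγ t ht).hasDerivAt
  have h2 : HasDerivAt (fun u => Φ (γ u)) (fderiv ℝ Φ (γ s) (deriv γ s)) s :=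
    (hΦ (γ s)).hasFDerivAt.comp_hasDerivAt s (hγ s hs).hasDerivAt
  refine h1.unique (h2.congr_of_eventuallyEq ?_)
  have hc : ContinuousAt (fun u => u + (t - s)) s := by fun_prop
  have hmem : ∀ᶠ u in 𝓝 s, u + (t - s) ∈ I :=
    hc.eventually (hI.mem_nhds (by simpa using ht))
  filter_upwards [hI.mem_nhds hs, hmem] with u hu hu'
  exact h u hu hu'

/-- The pairing of the vector field of a Randers metric with the velocity is constant along every
curve that runs along an orbit of a one-parameter group of isometries. -/
theorem RandersMetric.form_X_deriv_eq_of_orbit (R : RandersMetric E) {Φ : ℝ → E → E}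
    (hΦ : IsOneParamIsometryGroup R.F Φ) {γ : ℝ → E} {I : Set ℝ} (hI : IsOpen I)
    (hγ : ∀ t ∈ I, DifferentiableAt ℝ γ t) (horb : ∀ s ∈ I, ∀ t ∈ I, γ t = Φ (t - s) (γ s))
    {s t : ℝ} (hs : s ∈ I) (ht : t ∈ I) :
    R.g (γ t) (R.X (γ t)) (deriv γ t) = R.g (γ s) (R.X (γ s)) (deriv γ s) := by
  have hd : deriv γ t = fderiv ℝ (Φ (t - s)) (γ s) (deriv γ s) := by
    refine deriv_eq_fderiv_of_orbit hI hγ ((hΦ.smooth _).differentiable (by simp)) hs ht ?_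
    intro u hu hu'
    rw [horb u hu _ hu', add_sub_cancel_left]
  have h1 := R.half_F_sub (γ t) (deriv γ t)
  rw [hd, ← map_neg, horb s hs t ht, hΦ.isometry, hΦ.isometry, R.half_F_sub] at h1
  rw [hd, horb s hs t ht]
  linarith

end Isometry

/-- The exterior derivative of a one-form. -/
theorem extDeriv_ofSubsingleton {E : Type*} [NormedAddCommGroup E] [NormedSpace ℝ E]
    {θ : E → E →L[ℝ] ℝ} {θ' : E →L[ℝ] E →L[ℝ] ℝ} {x : E} (h : HasFDerivAt θ θ' x) (v w : E) :
    extDeriv (fun x => ContinuousAlternatingMap.ofSubsingleton ℝ E ℝ (0 : Fin 1) (θ x)) x ![v, w] =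
      θ' v w - θ' w v := by
  have hT := (ContinuousAlternatingMap.ofSubsingletonLIE (𝕜 := ℝ) (E := E) (F := ℝ)
    (0 : Fin 1)).toContinuousLinearEquiv.toContinuousLinearMap.hasFDerivAt.comp x h
  have hT' : HasFDerivAt
    (fun x => ContinuousAlternatingMap.ofSubsingleton ℝ E ℝ (0 : Fin 1) (θ x)) _ x := hT
  rw [extDeriv, hT'.fderiv, ContinuousAlternatingMap.alternatizeUncurryFin_apply,
    Fin.sum_univ_two]
  simp [Fin.removeNth, ContinuousAlternatingMap.ofSubsingletonLIE]
  ring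

/-- Bootstrapping: `c' = V ∘ c` is as smooth as `c`, up to the order of `V`. -/
theorem ContDiffOn.two_of_hasDerivAt {E : Type*} [NormedAddCommGroup E] [NormedSpace ℝ E]
    {V : E → E} {c : ℝ → E} {I : Set ℝ} (hI : IsOpen I)
    (hV : ∀ t ∈ I, ContDiffAt ℝ 1 V (c t)) (hc : ∀ t ∈ I, HasDerivAt c (V (c t)) t) :
    ContDiffOn ℝ 2 c I := by
  have hd : DifferentiableOn ℝ c I := fun t ht =>
    (hc t ht).differentiableAt.differentiableWithinAt
  have h0 : ContDiffOn ℝ 0 c I := contDiffOn_zero.2 hd.continuousOn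
  have step : ∀ m : ℕ, m ≤ 1 → ContDiffOn ℝ m c I → ContDiffOn ℝ (m + 1) c I := by
    intro m hm h
    rw [contDiffOn_succ_iff_deriv_of_isOpen hI]
    refine ⟨hd, by simp, ?_⟩
    refine ContDiffOn.congr (f := V ∘ c) ?_ fun t ht => (hc t ht).deriv
    intro t ht
    exact ((hV t ht).of_le (by exact_mod_cast hm)).comp_contDiffWithinAt t (h t ht)
  have h1 := step 0 zero_le_one (by simpa using h0)
  have h2 := step 1 le_rfl (by simpa using h1)
  norm_num at h2
  exact h2

/-! ### The geodesic equation -/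

namespace Heis

variable {n : ℕ}

/-- The geodesic vector field in terms of the point and the left-trivialized direction. -/
noncomputable def geodesicField (B : Heis n →L[ℝ] Heis n →L[ℝ] ℝ) (x : Heis n) (J : Heis n →L[ℝ] Heis n)
    (κ : ℝ) (p : Heis n × Heis n) : Heis n × Heis n :=
  ((1 + B x p.2)⁻¹ • (p.2 + omegaL n p.1 p.2 • centre n),
    (1 + B x p.2)⁻¹ • (2 * κ) • J p.2)

theorem contDiffAt_geodesicField (B : Heis n →L[ℝ] Heis n →L[ℝ] ℝ) (x : Heis n)
    (J : Heis n →L[ℝ] Heis n) (κ : ℝ) {p : Heis n × Heis n} (hp : 1 + B x p.2 ≠ 0) :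
    ContDiffAt ℝ 1 (geodesicField B x J κ) p := by
  have h1 : ContDiffAt ℝ 1 (fun p : Heis n × Heis n => (1 + B x p.2)⁻¹) p :=
    ContDiffAt.inv (by fun_prop) hp
  unfold geodesicField
  fun_prop

theorem eq_apply_zero_of_hasDerivAt_zero {f : ℝ → ℝ} {ε : ℝ} (hε : 0 < ε)
    (hf : ∀ t ∈ Ioo (-ε) ε, HasDerivAt f 0 t) {t : ℝ} (ht : t ∈ Ioo (-ε) ε) : f t = f 0 := by
  refine isOpen_Ioo.is_const_of_deriv_eq_zero isPreconnected_Ioo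
    (fun t ht => (hf t ht).differentiableAt.differentiableWithinAt)
    (fun t ht => (hf t ht).deriv) ht (by simpa using hε)

end Heis

namespace RandersMetric

variable {n : ℕ} {R : RandersMetric (Heis n)}

theorem F_eq_comp_trivialize (hR : Heis.LeftInvariant R.F) (a v : Heis n) :
    R.F a v ^ 2 / 2 =
      (fun y => randersNorm (R.g 0) (R.X 0) y ^ 2 / 2) (Heis.trivialize a v) := by
  rw [F_eq_of_leftInvariant hR]

/-- The momentum of a unit-speed velocity with left-trivialized direction `e`. -/
theorem fderiv_fiber (hR : Heis.LeftInvariant R.F) {a v e : Heis n}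
    (he : R.g 0 e e = 1) (hv : Heis.trivialize a v = (1 + R.g 0 (R.X 0) e)⁻¹ • e) :
    fderiv ℝ (fun y => R.F a y ^ 2 / 2) v =
      R.g 0 e + R.g 0 (R.X 0) -
        (R.g 0 e (Heis.centre n) + R.g 0 (R.X 0) (Heis.centre n)) • Heis.omegaL n a := by
  have hpos := form_apply_lt_one (R.symm_g 0) (R.pos_g 0) (R.lt_one 0) he
  have h := hasFDerivAt_half_sq_randersNorm (R.symm_g 0) (x := R.X 0) (inv_pos.2 hpos) he
  rw [inv_mul_cancel₀ hpos.ne', one_smul, ← hv] at h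
  have h2 := h.comp v (Heis.trivialize a).hasFDerivAt
  have h3 : HasFDerivAt (fun y => R.F a y ^ 2 / 2) _ v :=
    h2.congr_of_eventuallyEq (Eventually.of_forall (F_eq_comp_trivialize hR a))
  rw [h3.fderiv]
  ext w
  simp [Heis.trivialize_apply]
  ring

/-- The base point enters only through the central term of the trivialization, so only the central
momentum appears. -/
theorem fderiv_base (hR : Heis.LeftInvariant R.F) {a v e : Heis n}
    (he : R.g 0 e e = 1) (hv : Heis.trivialize a v = (1 + R.g 0 (R.X 0) e)⁻¹ • e) :
    fderiv ℝ (fun x => R.F x v ^ 2 / 2) a =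
      (R.g 0 e (Heis.centre n) + R.g 0 (R.X 0) (Heis.centre n)) • Heis.omegaL n v := by
  have hpos := form_apply_lt_one (R.symm_g 0) (R.pos_g 0) (R.lt_one 0) he
  have h := hasFDerivAt_half_sq_randersNorm (R.symm_g 0) (x := R.X 0) (inv_pos.2 hpos) he
  rw [inv_mul_cancel₀ hpos.ne', one_smul, ← hv] at h
  have ht : HasFDerivAt (fun x => Heis.trivialize x v)
      ((Heis.omegaL n v).smulRight (Heis.centre n)) a := by
    have h0 := (((Heis.omegaL n v).smulRight (Heis.centre n)).hasFDerivAt (x := a)).const_add v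
    refine h0.congr_of_eventuallyEq (Eventually.of_forall fun x => ?_)
    simp [Heis.trivialize_apply, Heis.omegaL_swap x v]
  have h2 := h.comp a ht
  have h3 : HasFDerivAt (fun x => R.F x v ^ 2 / 2) _ a :=
    h2.congr_of_eventuallyEq (Eventually.of_forall fun x => F_eq_comp_trivialize hR x v)
  rw [h3.fderiv]
  ext w
  simp
  ring

/-- For every unit vector `e₀` there is a geodesic through the unit element whose
left-trivialized direction starts at `e₀` and solves a linear equation up to parametrization. -/
theorem exists_geodesic (hR : Heis.LeftInvariant R.F) {J : Heis n →L[ℝ] Heis n}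
    (hJ : ∀ u w, R.g 0 (J u) w = Heis.omegaL n u w) {e₀ : Heis n} (he₀ : R.g 0 e₀ e₀ = 1)
    {κ : ℝ} (hκ : κ = R.g 0 e₀ (Heis.centre n) + R.g 0 (R.X 0) (Heis.centre n)) :
    ∃ (γ e : ℝ → Heis n) (ε : ℝ), 0 < ε ∧ e 0 = e₀ ∧ IsFinslerGeodesicOn R.F γ (Ioo (-ε) ε) ∧
      ∀ t ∈ Ioo (-ε) ε, 0 < 1 + R.g 0 (R.X 0) (e t) ∧
        Heis.trivialize (γ t) (deriv γ t) = (1 + R.g 0 (R.X 0) (e t))⁻¹ • e t ∧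
        HasDerivAt e ((1 + R.g 0 (R.X 0) (e t))⁻¹ • (2 * κ) • J (e t)) t := by
  set B := R.g 0 with hB
  set x := R.X 0 with hx
  have hpos : ∀ {e : Heis n}, B e e = 1 → 0 < 1 + B x e := fun he =>
    form_apply_lt_one (R.symm_g 0) (R.pos_g 0) (R.lt_one 0) he
  obtain ⟨c, hc0, ε, hε, hc⟩ :=
    (Heis.contDiffAt_geodesicField B x J κ (p := (0, e₀))
      (hpos he₀).ne').exists_forall_mem_closedBall_exists_eq_forall_mem_Ioo_hasDerivAt₀ 0
  simp only [zero_sub, zero_add] at hc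
  have hγ : ∀ t ∈ Ioo (-ε) ε, HasDerivAt (fun s => (c s).1)
      ((1 + B x (c t).2)⁻¹ • ((c t).2 + Heis.omegaL n (c t).1 (c t).2 • Heis.centre n)) t :=
    fun t ht => (ContinuousLinearMap.fst ℝ (Heis n) (Heis n)).hasFDerivAt.comp_hasDerivAt t
      (hc t ht)
  have he : ∀ t ∈ Ioo (-ε) ε, HasDerivAt (fun s => (c s).2)
      ((1 + B x (c t).2)⁻¹ • (2 * κ) • J (c t).2) t :=
    fun t ht => (ContinuousLinearMap.snd ℝ (Heis n) (Heis n)).hasFDerivAt.comp_hasDerivAt t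
      (hc t ht)
  -- `J` is `B`-skew because `ω` is alternating.
  have hunit : ∀ t ∈ Ioo (-ε) ε, B (c t).2 (c t).2 = 1 := by
    intro t ht
    rw [Heis.eq_apply_zero_of_hasDerivAt_zero (f := fun t => B (c t).2 (c t).2) hε ?_ ht]
    · simp [hc0, he₀]
    · intro s hs
      have h := (B.hasFDerivAt.comp_hasDerivAt s (he s hs)).clm_apply (he s hs)
      have h0 : B (c s).2 (J (c s).2) = 0 := by rw [hB, R.symm_g 0, ← hB, hJ, Heis.omegaL_self]
      refine h.congr_deriv ?_
      simp [hJ, h0]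
  -- `B(J e, z) = ω(e, z) = 0`: the frozen constant `κ` in the field is the true central momentum at
  -- all times.
  have hcen : ∀ t ∈ Ioo (-ε) ε, B (c t).2 (Heis.centre n) + B x (Heis.centre n) = κ := by
    intro t ht
    rw [hκ, Heis.eq_apply_zero_of_hasDerivAt_zero (f := fun t => B (c t).2 (Heis.centre n)) hε ?_ ht]
    · simp [hc0]
    · intro s hs
      have h := (B.flip (Heis.centre n)).hasFDerivAt.comp_hasDerivAt s (he s hs)
      refine h.congr_deriv ?_
      simp [hJ]
  have htriv : ∀ t ∈ Ioo (-ε) ε, Heis.trivialize (c t).1 (deriv (fun s => (c s).1) t) =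
      (1 + B x (c t).2)⁻¹ • (c t).2 := by
    intro t ht
    rw [(hγ t ht).deriv, map_smul, Heis.trivialize_translate]
  refine ⟨fun s => (c s).1, fun s => (c s).2, ε, hε, by simp [hc0], ⟨?_, ?_⟩, fun t ht =>
    ⟨hpos (hunit t ht), htriv t ht, he t ht⟩⟩
  · have h := ContDiffOn.two_of_hasDerivAt isOpen_Ioo
      (fun t ht => Heis.contDiffAt_geodesicField B x J κ (hpos (hunit t ht)).ne') hc
    exact contDiff_fst.comp_contDiffOn h
  · intro t ht
    have hr := hpos (hunit t ht)
    refine ⟨fun h0 => ?_, ?_⟩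
    · have h := htriv t ht
      rw [h0, map_zero] at h
      have h1 := (smul_eq_zero.1 h.symm).resolve_left (inv_ne_zero hr.ne')
      have h2 := hunit t ht
      rw [h1] at h2
      simp at h2
    · have hbase := fderiv_base hR (hunit t ht) (htriv t ht)
      rw [hbase, hcen t ht]
      -- The momentum and the base derivative each contribute `κ ω(γ', ·)`; this is the factor 2 in
      -- `geodesicField`.
      have hd : HasDerivAt (fun s => B (c s).2 + B x - κ • Heis.omegaL n (c s).1) _ t :=
        ((B.hasFDerivAt.comp_hasDerivAt t (he t ht)).add_const (B x)).sub
          (((Heis.omegaL n).hasFDerivAt.comp_hasDerivAt t (hγ t ht)).const_smul κ)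
      refine (hd.congr_of_eventuallyEq ?_).congr_deriv ?_
      · filter_upwards [isOpen_Ioo.mem_nhds ht] with s hs
        rw [fderiv_fiber hR (hunit s hs) (htriv s hs), hcen s hs]
      · rw [(hγ t ht).deriv]
        ext w
        simp [hJ]
        ring

/-! ### Consequences of the geodesic orbit property -/

/-- On a geodesic orbit space, a unit vector with nonzero momentum along the centre commutes with
the value of `X` at the unit element. -/
theorem momentum_mul_omegaL_eq_zero (hR : Heis.LeftInvariant R.F) (hGO : IsGeodesicOrbit R.F)
    {e₀ : Heis n} (he₀ : R.g 0 e₀ e₀ = 1) :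
    (R.g 0 e₀ (Heis.centre n) + R.g 0 (R.X 0) (Heis.centre n)) *
      Heis.omegaL n e₀ (R.X 0) = 0 := by
  obtain ⟨J, hJ⟩ := exists_form_representative (R.pos_g 0) (Heis.omegaL n)
  obtain ⟨γ, e, ε, hε, he0, hgeo, h⟩ := exists_geodesic hR hJ he₀ rfl
  obtain ⟨Φ, hΦ, horb⟩ := hGO γ _ isOpen_Ioo ordConnected_Ioo hgeo
  have h0 : (0 : ℝ) ∈ Ioo (-ε) ε := by simpa using hε
  have hdiff : ∀ t ∈ Ioo (-ε) ε, DifferentiableAt ℝ γ t := fun t ht =>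
    (hgeo.1.contDiffAt (isOpen_Ioo.mem_nhds ht)).differentiableAt (by norm_num)
  have hconst : ∀ t ∈ Ioo (-ε) ε, R.g 0 (R.X 0) (e t) = R.g 0 (R.X 0) (e 0) := by
    intro t ht
    have h1 := R.form_X_deriv_eq_of_orbit hΦ isOpen_Ioo hdiff horb h0 ht
    rw [form_X_of_leftInvariant hR (γ t), form_X_of_leftInvariant hR (γ 0), (h t ht).2.1,
      (h 0 h0).2.1,
      map_smul, map_smul, smul_eq_mul, smul_eq_mul] at h1
    have ht1 := (h t ht).1
    have h01 := (h 0 h0).1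
    -- The map `b ↦ b / (1 + b)` is injective where `1 + b > 0`.
    field_simp at h1
    linarith
  have hd := (R.g 0 (R.X 0)).hasFDerivAt.comp_hasDerivAt 0 (h 0 h0).2.2
  have hz : HasDerivAt (fun t => R.g 0 (R.X 0) (e t)) 0 0 :=
    (hasDerivAt_const (0 : ℝ) (R.g 0 (R.X 0) (e 0))).congr_of_eventuallyEq
      (by filter_upwards [isOpen_Ioo.mem_nhds h0] with t ht using hconst t ht)
  have hu := hd.unique hz
  have hr := (h 0 h0).1
  rw [he0] at hu hr
  simp only [map_smul, smul_eq_mul, R.symm_g 0 (R.X 0) (J e₀), hJ] at hu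
  have := (mul_eq_zero.1 hu).resolve_left (inv_ne_zero hr.ne')
  linarith

theorem omegaL_X_eq_zero (hR : Heis.LeftInvariant R.F) (hGO : IsGeodesicOrbit R.F)
    (w : Heis n) : Heis.omegaL n w (R.X 0) = 0 := by
  set z := Heis.centre n with hz
  have hzz := R.pos_g 0 z Heis.centre_ne_zero
  by_contra hw
  have hpos : ∀ s : ℝ, 0 < R.g 0 (w + s • z) (w + s • z) := by
    intro s
    refine R.pos_g 0 _ fun h0 => hw ?_
    have : Heis.omegaL n (w + s • z) (R.X 0) = 0 := by rw [h0]; simp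
    simpa [hz] using this
  have key : ∀ s : ℝ, (√(R.g 0 (w + s • z) (w + s • z)))⁻¹ * (R.g 0 w z + s * R.g 0 z z) +
      R.g 0 (R.X 0) z = 0 := by
    intro s
    have hs := Real.sqrt_pos.2 (hpos s)
    have h := momentum_mul_omegaL_eq_zero hR hGO
      (e₀ := (√(R.g 0 (w + s • z) (w + s • z)))⁻¹ • (w + s • z)) (by
        rw [map_smul, map_smul, smul_apply, smul_eq_mul, smul_eq_mul]
        field_simp
        exact (Real.sq_sqrt (hpos s).le).symm)
    set q := √(R.g 0 (w + s • z) (w + s • z))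
    have h2 := (mul_eq_zero.1 h).resolve_right (by
      rw [map_smul, smul_apply, smul_eq_mul]
      exact mul_ne_zero (inv_ne_zero hs.ne') (by simpa [hz] using hw))
    rw [← h2]
    simp [← hz, mul_add]
  -- These two values of `s` make `B(w + s z, z)` equal to `1` and `-1`, so `B(x, z)` would be both
  -- negative and positive.
  have h1 := key ((1 - R.g 0 w z) / R.g 0 z z)
  have h2 := key ((-1 - R.g 0 w z) / R.g 0 z z)
  rw [div_mul_cancel₀ _ hzz.ne'] at h1 h2
  have p1 := inv_pos.2 (Real.sqrt_pos.2 (hpos ((1 - R.g 0 w z) / R.g 0 z z)))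
  have p2 := inv_pos.2 (Real.sqrt_pos.2 (hpos ((-1 - R.g 0 w z) / R.g 0 z z)))
  nlinarith

theorem isZRanders_of_isGeodesicOrbit (hR : Heis.LeftInvariant R.F)
    (hGO : IsGeodesicOrbit R.F) : R.IsZRanders := by
  refine ⟨(R.X 0).2.2, fun a => ?_⟩
  have h0 := Heis.eq_smul_centre_of_omegaL_eq_zero (omegaL_X_eq_zero hR hGO)
  rw [Heis.Z_apply, ← Heis.translate_trivialize a (R.X a), trivialize_X hR a]
  nth_rw 2 [h0]
  rw [map_smul, Heis.omegaL_centre_right, smul_zero, zero_smul, add_zero]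
  exact h0

theorem IsDouglas.eq_zero_of_isZRanders (hn : 1 ≤ n) (hR : Heis.LeftInvariant R.F)
    (hD : R.IsDouglas) (hZ : R.IsZRanders) : R.X = 0 := by
  obtain ⟨c, hc⟩ := hZ
  simp only [Heis.Z_apply] at hc
  set z := Heis.centre n with hz
  have hform : ∀ x : Heis n, R.g x (R.X x) =
      c • R.g 0 z + (-(c * R.g 0 z z) • Heis.omegaL n) x := by
    intro x
    ext v
    rw [form_X_of_leftInvariant hR, hc 0, Heis.trivialize_apply]
    simp [← hz]
    ring
  have hd : HasFDerivAt (fun x => R.g x (R.X x)) (-(c * R.g 0 z z) • Heis.omegaL n) 0 :=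
    ((-(c * R.g 0 z z) • Heis.omegaL n).hasFDerivAt.const_add _).congr_of_eventuallyEq
      (Eventually.of_forall hform)
  -- A symplectic pair, available since `n ≥ 1`, detects `ω ≠ 0`.
  let i : Fin n := ⟨0, hn⟩
  let v : Heis n := (Pi.single i (1 : ℝ), (0 : Fin n → ℝ), (0 : ℝ))
  let w : Heis n := ((0 : Fin n → ℝ), Pi.single i (1 : ℝ), (0 : ℝ))
  have hvw : Heis.omegaL n v w = 1 := by
    rw [Heis.omegaL_apply]
    simp [Heis.omega, v, w, Pi.single_apply]
  have h : _ = (0 : ℝ) := (extDeriv_ofSubsingleton hd v w).symm.trans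
    (congrArg (fun f => f ![v, w]) (hD 0))
  simp only [smul_apply, Heis.omegaL_swap w v, hvw, smul_eq_mul] at h
  have hzz := R.pos_g 0 z Heis.centre_ne_zero
  have hc0 : c = 0 := by
    refine (mul_eq_zero.1 (?_ : c * R.g 0 z z = 0)).resolve_right hzz.ne'
    linarith
  funext a
  rw [hc a, hc0, zero_smul]
  rfl

end RandersMetric

theorem mainTheorem10 (n : ℕ) (hn : 1 ≤ n) (R : RandersMetric (Heis n))
    (hR : Heis.LeftInvariant R.F) :
    (R.X ≠ 0 → R.IsDouglas → ¬ IsGeodesicOrbit R.F) ∧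
      (IsGeodesicOrbit R.F → R.IsZRanders) := by
  have hZ := RandersMetric.isZRanders_of_isGeodesicOrbit hR
  exact ⟨fun hX hD hGO => hX (hD.eq_zero_of_isZRanders hn hR (hZ hGO)), hZ⟩
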